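/- Let $\mathcal H$ be a complex separable Hilbert space, let $(e_l)_{l\in\mathbb Z}$ be an orthonormal system in $\mathcal H$ (for instance an orthonormal basis), let $I\subset\mathbb R$ be bounded and Lebesgue measurable, and let $p\in[1,\infty)$. Let $\mathcal K$ be the space of compact operators and $\mathcal B_1$ the space of trace-class operators on $\mathcal H$, equipped with the weak-$*$ topology of $\mathcal B_1\cong\mathcal K^*$, i.e. the coarsest topology making all functionals $\rho\mapsto\operatorname{tr}(\rho\sigma)$, $\sigma\in\mathcal K$, continuous. Let $\tilde{\mathcal B}_1^+\subset\mathcal B_1$ be the set of positive semidefinite trace-class operators with the relative topology. Equip $L^2(I,\ell^p(\mathbb Z))$ (real sequence spaces, Lebesgue measure on $I$) with the weak-$*$ topology, i.e. the coarsest topology making all functionals $$f\mapsto\int_I\sum_{l\in\mathbb Z}f(\theta,l)\,a(\theta,l)\,\mathrm d\theta$$ continuous, where $a$ ranges over $L^2(I,c_0(\mathbb Z))$ if $p=1$ and over $L^2(I,\ell^{p'}(\mathbb Z))$ with $\frac1p+\frac1{p'}=1$ if $p>1$. Let $U_\theta$, $\theta\in I$, be bounded linear operators on $\mathcal H$ such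 that for every $\rho\in\tilde{\mathcal B}_1^+$ and every $l\in\mathbb Z$ the function $\theta\mapsto\langle e_l,U_\theta\rho U_\theta^*e_l\rangle$ is Lebesgue measurable on $I$. If $\{U_\theta:\theta\in I\}$ is uniformly bounded, i.e. $\sup_{\theta\in I}\|U_\theta\|<\infty$ (in particular, if all $U_\theta$ are unitary), then $$(T\rho)(\theta,l)=\langle e_l,U_\theta\rho U_\theta^*e_l\rangle$$ defines an operator $T:\tilde{\mathcal B}_1^+\to L^2(I,\ell^p(\mathbb Z))$, and $T$ is sequentially continuous from the weak-$*$ topology on $\tilde{\mathcal B}_1^+$ to the weak-$*$ topology on $L^2(I,\ell^p(\mathbb Z))$. -/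

import Mathlib

open MeasureTheory
open scoped ENNReal ZeroAtInfty InnerProduct

noncomputable section

section Operators

variable (H : Type*) [NormedAddCommGroup H] [InnerProductSpace ℂ H] [CompleteSpace H]

/-- The index set of a fixed, arbitrarily chosen orthonormal basis of `H`. -/
def stdIndex : Set H := (exists_hilbertBasis ℂ H).choose

/-- A fixed, arbitrarily chosen orthonormal basis of `H`. It is only used to write down traces,
which do not depend on it. -/
def stdBasis : HilbertBasis (stdIndex H) ℂ H := (exists_hilbertBasis ℂ H).choose_spec.choose

variable {H}

/-- The trace `tr A = ∑ᵢ ⟨fᵢ, A fᵢ⟩` of a (trace-class) operator. -/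
def opTrace (A : H →L[ℂ] H) : ℂ := ∑' i, inner ℂ (stdBasis H i) (A (stdBasis H i))

/-- Hilbert-Schmidt operators: compact with `∑ᵢ ‖A fᵢ‖² < ∞`. -/
def IsHilbertSchmidt (A : H →L[ℂ] H) : Prop :=
  IsCompactOperator A ∧ Summable fun i => ‖A (stdBasis H i)‖ ^ 2

/-- Trace-class operators: Hilbert-Schmidt with `tr |A| < ∞`, where `|A| = √(A* A)`. -/
def IsTraceClass (A : H →L[ℂ] H) : Prop :=
  IsHilbertSchmidt A ∧
    Summable fun i => (inner ℂ (stdBasis H i) (CFC.abs A (stdBasis H i))).re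

variable (H)

/-- The set `𝓑₁` of trace-class operators on `H`. -/
abbrev TraceClass : Type _ := {A : H →L[ℂ] H // IsTraceClass A}

/-- The set `𝓚` of compact operators on `H`. -/
abbrev CompactOp : Type _ := {A : H →L[ℂ] H // IsCompactOperator A}

/-- The weak-* topology on `𝓑₁ ≅ 𝓚*`: the coarsest topology which makes all the functionals
`ρ ↦ tr (ρ σ)`, `σ` compact, continuous. -/
@[reducible] def traceClassWeakStar : TopologicalSpace (TraceClass H) :=
  TopologicalSpace.induced
    (fun (ρ : TraceClass H) (σ : CompactOp H) => opTrace ((ρ : H →L[ℂ] H) ∘L (σ : H →L[ℂ] H)))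
    Pi.topologicalSpace

/-- The set of positive semidefinite trace-class operators. -/
abbrev PosTraceClass : Type _ := {ρ : TraceClass H // (ρ : H →L[ℂ] H).IsPositive}

/-- The weak-* topology on the positive semidefinite trace-class operators: the relative
topology as a subset of `𝓑₁`. -/
@[reducible] def posTraceClassWeakStar : TopologicalSpace (PosTraceClass H) :=
  TopologicalSpace.induced Subtype.val (traceClassWeakStar H)

end Operators

section MixedSpaces

/-- The real sequence space `ℓ^p(ℤ)`. -/
abbrev SeqLp (p : ℝ≥0∞) := lp (fun _ : ℤ => ℝ) p

/-- The real sequence space `c₀(ℤ)` of sequences vanishing at `±∞`, with the sup norm. -/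
abbrev SeqC0 := C₀(ℤ, ℝ)

instance fact_one_le_conjExponent (p : ℝ≥0∞) : Fact (1 ≤ p.conjExponent) :=
  ⟨by unfold ENNReal.conjExponent; exact le_self_add⟩

/-- The space `L²(I, ℓ^p(ℤ))` with respect to Lebesgue measure. -/
abbrev MixedL2 (I : Set ℝ) (p : ℝ≥0∞) [Fact (1 ≤ p)] := Lp (SeqLp p) 2 (volume.restrict I)

/-- The dual pairing `∫_I ∑ₗ f(θ, l) a(θ, l) dθ`. -/
def mixedPairing (I : Set ℝ) (f a : ℝ → ℤ → ℝ) : ℝ := ∫ θ in I, ∑' l, f θ l * a θ l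

open Classical in
/-- The weak-* topology on `L²(I, ℓ^p(ℤ))`, `1 ≤ p < ∞`: the coarsest topology which makes the
pairings with all the elements of the predual continuous, where the predual is `L²(I, c₀(ℤ))`
for `p = 1` and `L²(I, ℓ^{p'}(ℤ))` with `1/p + 1/p' = 1` for `1 < p < ∞`. -/
@[reducible] def mixedWeakStar (I : Set ℝ) (p : ℝ≥0∞) [Fact (1 ≤ p)] : TopologicalSpace (MixedL2 I p) :=
  if p = 1 then
    TopologicalSpace.induced
      (fun (f : MixedL2 I p) (a : Lp SeqC0 2 (volume.restrict I)) =>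
        mixedPairing I (fun θ l => f θ l) (fun θ l => a θ l))
      Pi.topologicalSpace
  else
    TopologicalSpace.induced
      (fun (f : MixedL2 I p) (a : MixedL2 I p.conjExponent) =>
        mixedPairing I (fun θ l => f θ l) (fun θ l => a θ l))
      Pi.topologicalSpace

end MixedSpaces

section ForwardOperator

variable {H : Type*} [NormedAddCommGroup H] [InnerProductSpace ℂ H] [CompleteSpace H]

/-- The number `⟨eₗ, U_θ ρ U_θ* eₗ⟩`. -/
def diagEntry (e : ℤ → H) (U : ℝ → H →L[ℂ] H) (ρ : H →L[ℂ] H) (θ : ℝ) (l : ℤ) : ℂ :=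
  inner ℂ (e l) ((U θ ∘L ρ ∘L (U θ).adjoint) (e l))

/-- `T` is the forward operator: `(T ρ)(θ, l) = ⟨eₗ, U_θ ρ U_θ* eₗ⟩` for almost every `θ ∈ I` and
all `l ∈ ℤ` (the right-hand side is real, as `ρ` is positive). -/
def IsForwardOperator (e : ℤ → H) (I : Set ℝ) (U : ℝ → H →L[ℂ] H) (p : ℝ≥0∞) [Fact (1 ≤ p)]
    (T : PosTraceClass H → MixedL2 I p) : Prop :=
  ∀ ρ : PosTraceClass H, ∀ᵐ θ ∂(volume.restrict I), ∀ l : ℤ,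
    ((T ρ θ l : ℝ) : ℂ) = diagEntry e U (ρ : TraceClass H) θ l

end ForwardOperator

end

/-!
Write `tr` for the trace, `S = √ρ` for a positive trace-class operator `ρ`, and `fᵢ` for the
reference orthonormal basis.

*The range.* We have `⟨eₗ, U_θ ρ U_θ* eₗ⟩ = ‖S U_θ* eₗ‖²`. Expanding in the basis `fᵢ`, moving `S`
and `U_θ*` to the other side of the inner product and applying Bessel's inequality for `(eₗ)` gives
`∑ₗ ‖S U_θ* eₗ‖² ≤ ‖U_θ‖² ∑ᵢ ‖S fᵢ‖² = ‖U_θ‖² tr ρ` (`sum_norm_sq_comp_le`). As `‖U_θ‖` is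
bounded on `I`, `T ρ` is bounded with values in `ℓ¹ ⊆ ℓ^p`, and since `I` is bounded it belongs to
`L²(I, ℓ^p)`; as `p < ∞`, its measurability can be checked coordinatewise.

*Sequential continuity.* Let `ρₙ → ρ` weak-*. The functionals `σ ↦ tr (ρₙ σ)` on the Banach space
of compact operators are pointwise bounded, hence uniformly bounded by Banach-Steinhaus, and
testing on finite-rank projections shows `sup tr ρₙ < ∞` (`exists_realTrace_le_of_tendsto`). So the
sequences `(T ρₙ)(θ, ·)` are bounded in `ℓ¹`, uniformly in `n` and `θ ∈ I`. Testing on the rank-one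
operator `|x⟩⟨x|` with `x = U_θ* eₗ` shows `(T ρₙ)(θ, l) → (T ρ)(θ, l)` for `θ ∈ I`, `l ∈ ℤ`. An
element `a` of the predual has `a(θ) ∈ c₀` in both cases `p = 1` and `p > 1`, so the sums over `l`
in the pairing converge for each `θ` (`tendsto_tsum_mul_of_tendsto_cofinite`). They are dominated by
a constant times `‖a(θ)‖`, which is integrable because `I` has finite measure, and the dominated
convergence theorem concludes (`tendsto_mixedPairing`).
-/

open Filter Topology

/-! ### Trace estimates for positive trace-class operators -/

section TraceEstimates

variable {H : Type*} [NormedAddCommGroup H] [InnerProductSpace ℂ H] [CompleteSpace H]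

/-- The sum `∑ᵢ Re ⟨fᵢ, ρ fᵢ⟩` over the reference orthonormal basis: the trace, as a real number,
of a positive trace-class operator `ρ`. -/
noncomputable def realTrace (ρ : H →L[ℂ] H) : ℝ :=
  ∑' i, (inner ℂ (stdBasis H i) (ρ (stdBasis H i))).re

/-- A positive trace-class operator `ρ` is the square of a self-adjoint Hilbert-Schmidt operator
`S`; its trace is then the squared Hilbert-Schmidt norm of `S`. -/
lemma exists_sqrt_of_posTraceClass (ρ : PosTraceClass H) :
    ∃ S : H →L[ℂ] H, (∀ x y, inner ℂ x ((ρ : TraceClass H).1 y) = inner ℂ (S x) (S y)) ∧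
      (∀ x y, inner ℂ (S x) y = inner ℂ x (S y)) ∧
      HasSum (fun i => ‖S (stdBasis H i)‖ ^ 2) (realTrace (ρ : TraceClass H).1) := by
  obtain ⟨⟨A, hA⟩, hpos : A.IsPositive⟩ := ρ
  have h0 : 0 ≤ A := (ContinuousLinearMap.nonneg_iff_isPositive A).2 hpos
  have hS : (CFC.sqrt A).IsPositive :=
    (ContinuousLinearMap.nonneg_iff_isPositive _).1 (CFC.sqrt_nonneg A)
  have hsymm : ∀ x y, inner ℂ (CFC.sqrt A x) y = inner ℂ x (CFC.sqrt A y) := hS.isSymmetric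
  have hsq : ∀ x y, inner ℂ x (A y) = inner ℂ (CFC.sqrt A x) (CFC.sqrt A y) := by
    intro x y
    rw [hsymm, ← mul_apply_eq_comp, CFC.sqrt_mul_sqrt_self A h0]
  refine ⟨CFC.sqrt A, hsq, hsymm, ?_⟩
  have hsum := hA.2
  rw [CFC.abs_of_nonneg A h0] at hsum
  have hterm : (fun i => ‖CFC.sqrt A (stdBasis H i)‖ ^ 2) =
      fun i => (inner ℂ (stdBasis H i) (A (stdBasis H i))).re := by
    funext i
    rw [hsq, inner_self_eq_norm_sq_to_K]
    norm_cast
  rw [hterm]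
  exact hsum.hasSum

lemma realTrace_nonneg (ρ : PosTraceClass H) : 0 ≤ realTrace (ρ : TraceClass H).1 := by
  obtain ⟨S, -, -, hS⟩ := exists_sqrt_of_posTraceClass ρ
  exact hS.nonneg fun i => by positivity

/-- Basis independence of the Hilbert-Schmidt norm, in the form of an inequality which allows an
orthonormal system and an additional bounded factor `V`. -/
lemma sum_norm_sq_comp_le {ι : Type*} {e : ι → H} (he : Orthonormal ℂ e) {S : H →L[ℂ] H}
    (hsymm : ∀ x y, inner ℂ (S x) y = inner ℂ x (S y)) {t : ℝ}
    (hS : HasSum (fun i => ‖S (stdBasis H i)‖ ^ 2) t) (V : H →L[ℂ] H) (F : Finset ι) :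
    ∑ l ∈ F, ‖S (V (e l))‖ ^ 2 ≤ ‖V‖ ^ 2 * t := by
  have hparseval : ∀ x : H, HasSum (fun i => ‖inner ℂ (stdBasis H i) x‖ ^ 2) (‖x‖ ^ 2) := by
    intro x
    have h := ((stdBasis H).hasSum_inner_mul_inner x x).mapL Complex.reCLM
    rw [inner_self_eq_norm_sq_to_K] at h
    convert h using 1
    · funext i
      rw [← inner_conj_symm x, RCLike.conj_mul]
      simp [← Complex.ofReal_pow]
    · simp [← Complex.ofReal_pow]
  have hleft : HasSum (fun i => ∑ l ∈ F, ‖inner ℂ (stdBasis H i) (S (V (e l)))‖ ^ 2)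
      (∑ l ∈ F, ‖S (V (e l))‖ ^ 2) :=
    hasSum_sum fun l _ => hparseval _
  refine hasSum_le (fun i => ?_) hleft (hS.mul_left (‖V‖ ^ 2))
  have hadj : ∀ l, ‖inner ℂ (stdBasis H i) (S (V (e l)))‖ =
      ‖inner ℂ (e l) (V.adjoint (S (stdBasis H i)))‖ := by
    intro l
    rw [← hsymm, ← ContinuousLinearMap.adjoint_inner_left, norm_inner_symm]
  simp only [hadj]
  refine (he.sum_inner_products_le _).trans ?_
  rw [← mul_pow]
  gcongr
  refine (V.adjoint.le_opNorm _).trans_eq ?_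
  rw [LinearIsometryEquiv.norm_map]

/-- `|tr (ρ σ)| ≤ tr ρ ‖σ‖`, with absolute convergence of the trace. -/
lemma summable_and_norm_opTrace_le (ρ : PosTraceClass H) (σ : H →L[ℂ] H) :
    Summable (fun i => inner ℂ (stdBasis H i)
      (((ρ : TraceClass H).1 ∘L σ) (stdBasis H i))) ∧
      ‖opTrace ((ρ : TraceClass H).1 ∘L σ)‖ ≤ realTrace (ρ : TraceClass H).1 * ‖σ‖ := by
  obtain ⟨S, hsq, hsymm, hS⟩ := exists_sqrt_of_posTraceClass ρ
  set t := realTrace (ρ : TraceClass H).1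
  rcases eq_or_ne σ 0 with rfl | hσ
  · simp [opTrace, summable_zero]
  have hσ' : 0 < ‖σ‖ := norm_pos_iff.2 hσ
  have ht : 0 ≤ t := realTrace_nonneg ρ
  have hle : ∀ F : Finset (stdIndex H), ∑ i ∈ F, ‖inner ℂ (stdBasis H i)
      (((ρ : TraceClass H).1 ∘L σ) (stdBasis H i))‖ ≤ t * ‖σ‖ := by
    intro F
    have h1 := sum_le_hasSum F (fun i _ => by positivity) hS
    have h2 := sum_norm_sq_comp_le (stdBasis H).orthonormal hsymm hS σ F
    -- the arithmetic-geometric mean inequality with weights `‖σ‖` and `‖σ‖⁻¹`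
    have hterm : ∀ i ∈ F, ‖inner ℂ (stdBasis H i)
        (((ρ : TraceClass H).1 ∘L σ) (stdBasis H i))‖ ≤
        ‖σ‖ / 2 * ‖S (stdBasis H i)‖ ^ 2 + ‖σ‖⁻¹ / 2 * ‖S (σ (stdBasis H i))‖ ^ 2 := by
      intro i _
      rw [ContinuousLinearMap.comp_apply, hsq]
      refine (norm_inner_le_norm _ _).trans ?_
      have h := sq_nonneg (‖σ‖ * ‖S (stdBasis H i)‖ - ‖S (σ (stdBasis H i))‖)
      have h' := mul_nonneg (inv_nonneg.2 hσ'.le) h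
      have e1 : ‖σ‖⁻¹ * (‖σ‖ * ‖S (stdBasis H i)‖ - ‖S (σ (stdBasis H i))‖) ^ 2 =
          ‖σ‖ * ‖S (stdBasis H i)‖ ^ 2 - 2 * (‖S (stdBasis H i)‖ * ‖S (σ (stdBasis H i))‖)
            + ‖σ‖⁻¹ * ‖S (σ (stdBasis H i))‖ ^ 2 := by
        field_simp
        ring
      linarith
    refine (Finset.sum_le_sum hterm).trans ?_
    rw [Finset.sum_add_distrib, ← Finset.mul_sum, ← Finset.mul_sum]
    calc _ ≤ ‖σ‖ / 2 * t + ‖σ‖⁻¹ / 2 * (‖σ‖ ^ 2 * t) := by gcongr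
      _ = t * ‖σ‖ := by field_simp; ring
  have hsum := summable_of_sum_le (fun i => norm_nonneg _) hle
  exact ⟨hsum.of_norm, (norm_tsum_le_tsum_norm hsum).trans (hsum.tsum_le_of_sum_le hle)⟩

/-- The functional `σ ↦ tr (ρ σ)` on the Banach space of compact operators. -/
noncomputable def traceFunctional (ρ : PosTraceClass H) :
    compactOperator (RingHom.id ℂ) H H →L[ℂ] ℂ :=
  LinearMap.mkContinuous
    { toFun := fun σ => opTrace ((ρ : TraceClass H).1 ∘L σ.1)
      map_add' := fun σ τ => by
        have h := (summable_and_norm_opTrace_le ρ σ.1).1.tsum_add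
          (summable_and_norm_opTrace_le ρ τ.1).1
        simpa [opTrace, inner_add_right] using h
      map_smul' := fun c σ => by
        simp [opTrace, tsum_mul_left] }
    (realTrace (ρ : TraceClass H).1) fun σ => (summable_and_norm_opTrace_le ρ σ.1).2

lemma traceFunctional_apply (ρ : PosTraceClass H) (σ : compactOperator (RingHom.id ℂ) H H) :
    traceFunctional ρ σ = opTrace ((ρ : TraceClass H).1 ∘L σ.1) := rfl

lemma isCompactOperator_rankOne {H : Type*} [NormedAddCommGroup H] [InnerProductSpace ℂ H]
    (x y : H) :
    IsCompactOperator (InnerProductSpace.rankOne ℂ x y) := by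
  rw [InnerProductSpace.rankOne_def']
  have h : IsCompactOperator (ContinuousLinearMap.toSpanSingleton ℂ x) :=
    isCompactOperator_of_locallyCompactSpace_rng _
  exact h.comp_clm (innerSL ℂ y)

lemma opTrace_comp_rankOne (A : H →L[ℂ] H) (x y : H) :
    opTrace (A ∘L InnerProductSpace.rankOne ℂ x y) = inner ℂ y (A x) := by
  rw [← (stdBasis H).tsum_inner_mul_inner y (A x), opTrace]
  refine tsum_congr fun i => ?_
  simp

/-- A sum of rank-one projections onto pairwise orthogonal unit vectors is a contraction. -/
lemma norm_sum_rankOne_le {H ι : Type*} [NormedAddCommGroup H] [InnerProductSpace ℂ H]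
    {e : ι → H} (he : Orthonormal ℂ e) (F : Finset ι) :
    ‖∑ i ∈ F, InnerProductSpace.rankOne ℂ (e i) (e i)‖ ≤ 1 := by
  refine ContinuousLinearMap.opNorm_le_bound _ zero_le_one fun x => ?_
  have h : ‖∑ i ∈ F, inner ℂ (e i) x • e i‖ ^ 2 = ∑ i ∈ F, ‖inner ℂ (e i) x‖ ^ 2 := by
    have h1 := he.inner_sum (fun i => inner ℂ (e i) x) (fun i => inner ℂ (e i) x) F
    rw [inner_self_eq_norm_sq_to_K] at h1
    simp only [RCLike.conj_mul] at h1
    exact_mod_cast h1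
  rw [one_mul, ← sq_le_sq₀ (norm_nonneg _) (norm_nonneg _)]
  simpa [h] using he.sum_inner_products_le x (s := F)

/-- The trace is recovered from the finite-rank contractions. -/
lemma realTrace_le_norm_traceFunctional (ρ : PosTraceClass H) :
    realTrace (ρ : TraceClass H).1 ≤ ‖traceFunctional ρ‖ := by
  obtain ⟨S, hsq, -, hS⟩ := exists_sqrt_of_posTraceClass ρ
  refine hasSum_le_of_sum_le hS fun F => ?_
  let P : stdIndex H → compactOperator (RingHom.id ℂ) H H := fun i =>
    ⟨InnerProductSpace.rankOne ℂ (stdBasis H i) (stdBasis H i), isCompactOperator_rankOne _ _⟩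
  have hP : ‖∑ i ∈ F, P i‖ ≤ 1 := by
    have h := norm_sum_rankOne_le (stdBasis H).orthonormal F
    change ‖((∑ i ∈ F, P i : compactOperator (RingHom.id ℂ) H H) : H →L[ℂ] H)‖ ≤ 1
    simpa [P] using h
  have hval : traceFunctional ρ (∑ i ∈ F, P i) =
      ((∑ i ∈ F, ‖S (stdBasis H i)‖ ^ 2 : ℝ) : ℂ) := by
    rw [map_sum, Complex.ofReal_sum]
    refine Finset.sum_congr rfl fun i _ => ?_
    rw [traceFunctional_apply, opTrace_comp_rankOne, hsq, inner_self_eq_norm_sq_to_K]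
    norm_cast
  calc ∑ i ∈ F, ‖S (stdBasis H i)‖ ^ 2 = ‖traceFunctional ρ (∑ i ∈ F, P i)‖ := by
        rw [hval, Complex.norm_of_nonneg (Finset.sum_nonneg fun i _ => by positivity)]
    _ ≤ ‖traceFunctional ρ‖ * 1 := (traceFunctional ρ).le_of_opNorm_le_of_le le_rfl hP
    _ = ‖traceFunctional ρ‖ := mul_one _

/-- Weak-* convergence, tested against each compact operator. -/
lemma tendsto_posTraceClass_iff {ρ : ℕ → PosTraceClass H} {ρ₀ : PosTraceClass H} :
    Tendsto ρ atTop (@nhds _ (posTraceClassWeakStar H) ρ₀) ↔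
      ∀ σ : CompactOp H, Tendsto (fun n => opTrace ((ρ n : TraceClass H).1 ∘L σ.1)) atTop
        (𝓝 (opTrace ((ρ₀ : TraceClass H).1 ∘L σ.1))) := by
  have hind : posTraceClassWeakStar H = TopologicalSpace.induced
      (fun (ρ : PosTraceClass H) (σ : CompactOp H) => opTrace ((ρ : TraceClass H).1 ∘L σ.1))
      Pi.topologicalSpace := induced_compose
  rw [hind, nhds_induced, tendsto_comap_iff, tendsto_pi_nhds]
  rfl

/-- By the uniform boundedness principle, traces are bounded along weak-* convergent sequences. -/
lemma exists_realTrace_le_of_tendsto {ρ : ℕ → PosTraceClass H} {ρ₀ : PosTraceClass H}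
    (h : Tendsto ρ atTop (@nhds _ (posTraceClassWeakStar H) ρ₀)) :
    ∃ M, ∀ n, realTrace (ρ n : TraceClass H).1 ≤ M := by
  have hclosed : IsClosed (compactOperator (RingHom.id ℂ) H H : Set (H →L[ℂ] H)) :=
    isClosed_setOfPred_isCompactOperator
  have : CompleteSpace (compactOperator (RingHom.id ℂ) H H) :=
    hclosed.completeSpace_coe
  obtain ⟨M, hM⟩ := banach_steinhaus (g := fun n => traceFunctional (ρ n)) fun σ => by
    have hb := (tendsto_posTraceClass_iff.1 h ⟨σ.1, σ.2⟩).norm.bddAbove_range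
    exact ⟨_, fun n => hb.choose_spec ⟨n, rfl⟩⟩
  exact ⟨M, fun n => (realTrace_le_norm_traceFunctional _).trans (hM n)⟩

lemma tendsto_inner_of_tendsto {ρ : ℕ → PosTraceClass H} {ρ₀ : PosTraceClass H}
    (h : Tendsto ρ atTop (@nhds _ (posTraceClassWeakStar H) ρ₀)) (x : H) :
    Tendsto (fun n => inner ℂ x ((ρ n : TraceClass H).1 x)) atTop
      (𝓝 (inner ℂ x ((ρ₀ : TraceClass H).1 x))) := by
  simpa only [opTrace_comp_rankOne] using tendsto_posTraceClass_iff.1 h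
    ⟨InnerProductSpace.rankOne ℂ x x, isCompactOperator_rankOne x x⟩

lemma diagEntry_eq (e : ℤ → H) (U : ℝ → H →L[ℂ] H) (A : H →L[ℂ] H) (θ : ℝ) (l : ℤ) :
    diagEntry e U A θ l = inner ℂ ((U θ).adjoint (e l)) (A ((U θ).adjoint (e l))) := by
  rw [diagEntry, ContinuousLinearMap.adjoint_inner_left]
  rfl

lemma diagEntry_eq_ofReal_and_nonneg (e : ℤ → H) (U : ℝ → H →L[ℂ] H) (ρ : PosTraceClass H)
    (θ : ℝ) (l : ℤ) :
    diagEntry e U (ρ : TraceClass H).1 θ l =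
        ((diagEntry e U (ρ : TraceClass H).1 θ l).re : ℂ) ∧
      0 ≤ (diagEntry e U (ρ : TraceClass H).1 θ l).re := by
  obtain ⟨S, hsq, -, -⟩ := exists_sqrt_of_posTraceClass ρ
  have h : diagEntry e U (ρ : TraceClass H).1 θ l =
      ((‖S ((U θ).adjoint (e l))‖ ^ 2 : ℝ) : ℂ) := by
    rw [diagEntry_eq, hsq, inner_self_eq_norm_sq_to_K]
    norm_cast
  rw [h, Complex.ofReal_re]
  exact ⟨rfl, by positivity⟩

/-- The diagonal of `U_θ ρ U_θ*` has `ℓ¹` norm at most `‖U_θ‖² tr ρ`. -/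
lemma sum_re_diagEntry_le {e : ℤ → H} (he : Orthonormal ℂ e) (U : ℝ → H →L[ℂ] H)
    (ρ : PosTraceClass H) (θ : ℝ) (F : Finset ℤ) :
    ∑ l ∈ F, (diagEntry e U (ρ : TraceClass H).1 θ l).re ≤
      ‖U θ‖ ^ 2 * realTrace (ρ : TraceClass H).1 := by
  obtain ⟨S, hsq, hsymm, hS⟩ := exists_sqrt_of_posTraceClass ρ
  have h := sum_norm_sq_comp_le he hsymm hS (U θ).adjoint F
  rw [LinearIsometryEquiv.norm_map] at h
  convert h using 2 with l
  rw [diagEntry_eq, hsq, inner_self_eq_norm_sq_to_K]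
  norm_cast

end TraceEstimates

/-! ### Bounded sequences in `ℓ¹` tested against null sequences -/

section Sequences

variable {ι : Type*}

lemma summable_and_norm_tsum_mul_le [Nonempty ι] {x a : ι → ℝ} {K b : ℝ}
    (hx : ∀ F : Finset ι, ∑ i ∈ F, |x i| ≤ K) (hb : ∀ i, |a i| ≤ b) :
    Summable (fun i => x i * a i) ∧ ‖∑' i, x i * a i‖ ≤ K * b := by
  have hs : Summable fun i => |x i| := summable_of_sum_le (fun i => abs_nonneg _) hx
  have hle : ∀ i, ‖x i * a i‖ ≤ |x i| * b := fun i => by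
    rw [norm_mul, Real.norm_eq_abs, Real.norm_eq_abs]
    exact mul_le_mul_of_nonneg_left (hb i) (abs_nonneg _)
  refine ⟨(hs.mul_right b).of_norm_bounded hle, ?_⟩
  refine (tsum_of_norm_bounded (hs.hasSum.mul_right b) hle).trans ?_
  gcongr
  · exact (abs_nonneg _).trans (hb (Classical.arbitrary ι))
  · exact hs.tsum_le_of_sum_le hx

/-- A sequence which is bounded in `ℓ¹` and converges coordinatewise converges when tested
against sequences vanishing at infinity. -/
lemma tendsto_tsum_mul_of_tendsto_cofinite [Nonempty ι] {x : ℕ → ι → ℝ} {x₀ a : ι → ℝ} {K b : ℝ}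
    (hx : ∀ n, ∀ F : Finset ι, ∑ i ∈ F, |x n i| ≤ K)
    (hlim : ∀ i, Tendsto (fun n => x n i) atTop (𝓝 (x₀ i)))
    (hb : ∀ i, |a i| ≤ b) (ha : Tendsto a cofinite (𝓝 0)) :
    Tendsto (fun n => ∑' i, x n i * a i) atTop (𝓝 (∑' i, x₀ i * a i)) := by
  have hx₀ : ∀ F : Finset ι, ∑ i ∈ F, |x₀ i| ≤ K := fun F =>
    le_of_tendsto' (tendsto_finsetSum F fun i _ => (hlim i).abs) fun n => hx n F
  have hK : 0 ≤ K := by simpa using hx₀ ∅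
  rw [Metric.tendsto_atTop]
  intro ε hε
  obtain ⟨δ, hδ, hδε⟩ : ∃ δ > 0, 2 * K * δ < ε / 2 :=
    ⟨ε / 2 / (2 * K + 1), by positivity, by
      rw [mul_div_assoc', div_lt_iff₀ (by positivity)]
      nlinarith⟩
  have hfin : {i | ¬ |a i| < δ}.Finite := by
    have h := ha.eventually (Metric.ball_mem_nhds 0 hδ)
    simpa [Filter.eventually_cofinite] using h
  let F := hfin.toFinset
  have hF : ∀ i ∉ F, |a i| ≤ δ := fun i hi => by
    by_contra h
    exact hi (hfin.mem_toFinset.2 fun h' => h h'.le)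
  have hhead : Tendsto (fun n => ∑ i ∈ F, |x n i - x₀ i| * |a i|) atTop (𝓝 0) := by
    have h : Tendsto (fun n => ∑ i ∈ F, |x n i - x₀ i| * |a i|) atTop
        (𝓝 (∑ i ∈ F, |x₀ i - x₀ i| * |a i|)) :=
      tendsto_finsetSum F fun i _ => (((hlim i).sub_const _).abs).mul_const _
    simpa using h
  obtain ⟨N, hN⟩ := eventually_atTop.1 (hhead.eventually (gt_mem_nhds (half_pos hε)))
  refine ⟨N, fun n hn => ?_⟩
  rw [Real.dist_eq, ← (summable_and_norm_tsum_mul_le (hx n) hb).1.tsum_sub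
    (summable_and_norm_tsum_mul_le hx₀ hb).1]
  have hle : ∀ G : Finset ι, ∑ i ∈ G, ‖x n i * a i - x₀ i * a i‖ ≤
      ∑ i ∈ F, |x n i - x₀ i| * |a i| + 2 * K * δ := by
    classical
    intro G
    have hterm : ∀ i, ‖x n i * a i - x₀ i * a i‖ = |x n i - x₀ i| * |a i| := fun i => by
      rw [← sub_mul, norm_mul, Real.norm_eq_abs, Real.norm_eq_abs]
    simp only [hterm]
    rw [← Finset.sum_filter_add_sum_filter_not G (· ∈ F)]
    refine add_le_add (Finset.sum_le_sum_of_subset_of_nonneg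
      (fun i hi => (Finset.mem_filter.1 hi).2) fun i _ _ => by positivity) ?_
    calc ∑ i ∈ G with i ∉ F, |x n i - x₀ i| * |a i|
        ≤ ∑ i ∈ G with i ∉ F, (|x n i| + |x₀ i|) * δ := by
          refine Finset.sum_le_sum fun i hi => ?_
          exact mul_le_mul (abs_sub _ _) (hF i (Finset.mem_filter.1 hi).2) (abs_nonneg _)
            (by positivity)
      _ ≤ 2 * K * δ := by
          rw [← Finset.sum_mul, Finset.sum_add_distrib]
          have h1 := hx n (G.filter (· ∉ F))
          have h2 := hx₀ (G.filter (· ∉ F))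
          gcongr
          linarith
  have hs := summable_of_sum_le (fun i => norm_nonneg _) hle
  calc |∑' i, (x n i * a i - x₀ i * a i)| ≤ ∑ i ∈ F, |x n i - x₀ i| * |a i| + 2 * K * δ :=
        (norm_tsum_le_tsum_norm hs).trans (hs.tsum_le_of_sum_le hle)
    _ < ε := by linarith [hN n hn]

lemma memℓp_of_sum_abs_le {p : ℝ≥0∞} (hp : 1 ≤ p) {x : ι → ℝ} {K : ℝ}
    (hx : ∀ F : Finset ι, ∑ i ∈ F, |x i| ≤ K) : Memℓp x p :=
  (memℓp_gen' (p := 1) (C := K) (by simpa using hx)).of_exponent_ge hp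

/-- The inequality `‖x‖_p ≤ ‖x‖₁`, from the triangle inequality for `x = ∑ᵢ xᵢ δᵢ`. -/
lemma norm_lp_le_of_sum_abs_le {p : ℝ≥0∞} [Fact (1 ≤ p)] (hp : p ≠ ∞)
    {x : lp (fun _ : ι => ℝ) p} {K : ℝ} (hx : ∀ F : Finset ι, ∑ i ∈ F, |x i| ≤ K) : ‖x‖ ≤ K := by
  classical
  refine le_of_tendsto (lp.hasSum_single hp x).norm (Eventually.of_forall fun F => ?_)
  refine (norm_sum_le _ _).trans ((Finset.sum_le_sum fun i _ => ?_).trans (hx F))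
  rw [lp.norm_single (zero_lt_one.trans_le Fact.out), Real.norm_eq_abs]

lemma lp_tendsto_cofinite_zero {p : ℝ≥0∞} [Fact (1 ≤ p)] (hp : p ≠ ∞)
    (x : lp (fun _ : ι => ℝ) p) : Tendsto (fun i => x i) cofinite (𝓝 0) := by
  classical
  have h := (lp.hasSum_single hp x).summable.tendsto_cofinite_zero.norm
  simp only [lp.norm_single (zero_lt_one.trans_le (Fact.out : 1 ≤ p)), norm_zero] at h
  exact tendsto_zero_iff_norm_tendsto_zero.2 h

/-- Measurability into `ℓ^p`, `p < ∞`, can be checked coordinatewise. -/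
lemma aestronglyMeasurable_lp {α : Type*} [MeasurableSpace α] {μ : Measure α} [Countable ι]
    {p : ℝ≥0∞} [Fact (1 ≤ p)] (hp : p ≠ ∞) {f : α → lp (fun _ : ι => ℝ) p}
    (hf : ∀ i, AEMeasurable (fun θ => f θ i) μ) : AEStronglyMeasurable f μ := by
  classical
  refine aestronglyMeasurable_of_tendsto_ae (atTop : Filter (Finset ι))
    (f := fun F θ => ∑ i ∈ F, lp.single p i (f θ i)) (fun F => ?_)
    (Eventually.of_forall fun θ => lp.hasSum_single hp (f θ))
  refine Finset.aestronglyMeasurable_fun_sum F fun i _ => ?_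
  exact (lp.isometry_single i).continuous.comp_aestronglyMeasurable (hf i).aestronglyMeasurable

end Sequences

/-! ### Weak-* convergence in `L²(I, ℓ^p(ℤ))` -/

section Pairing

variable {I : Set ℝ}

/-- Dominated convergence for the dual pairing. -/
lemma tendsto_mixedPairing {f : ℕ → ℝ → ℤ → ℝ} {f₀ a : ℝ → ℤ → ℝ} {b : ℝ → ℝ} {K : ℝ}
    (hfm : ∀ n l, AEMeasurable (fun θ => f n θ l) (volume.restrict I))
    (ham : ∀ l, AEMeasurable (fun θ => a θ l) (volume.restrict I))
    (hf : ∀ n, ∀ᵐ θ ∂(volume.restrict I), ∀ F : Finset ℤ, ∑ l ∈ F, |f n θ l| ≤ K)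
    (hlim : ∀ᵐ θ ∂(volume.restrict I), ∀ l, Tendsto (fun n => f n θ l) atTop (𝓝 (f₀ θ l)))
    (hb : Integrable b (volume.restrict I)) (hab : ∀ θ l, |a θ l| ≤ b θ)
    (ha : ∀ θ, Tendsto (a θ) cofinite (𝓝 0)) :
    Tendsto (fun n => mixedPairing I (f n) a) atTop (𝓝 (mixedPairing I f₀ a)) := by
  refine tendsto_integral_of_dominated_convergence (fun θ => K * b θ) (fun n => ?_)
    (hb.const_mul K) (fun n => ?_) ?_
  · exact (AEMeasurable.tsum fun l => (hfm n l).mul (ham l)).aestronglyMeasurable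
  · filter_upwards [hf n] with θ hθ
    exact (summable_and_norm_tsum_mul_le hθ (hab θ)).2
  · filter_upwards [ae_all_iff.2 hf, hlim] with θ h1 h2
    exact tendsto_tsum_mul_of_tendsto_cofinite h1 h2 (hab θ) (ha θ)

/-- Weak-* convergence in `L²(I, ℓ^p(ℤ))` of a sequence which is bounded in `L^∞(I, ℓ¹(ℤ))` and
converges coordinatewise almost everywhere. Each predual element `a` has `a(θ) ∈ c₀(ℤ)`, also for
`p > 1`, because then `p' < ∞`. -/
lemma tendsto_mixedWeakStar (hI : volume I ≠ ∞) {p : ℝ≥0∞} [Fact (1 ≤ p)]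
    {f : ℕ → MixedL2 I p} {f₀ : MixedL2 I p} {K : ℝ}
    (hf : ∀ n, ∀ᵐ θ ∂(volume.restrict I), ∀ F : Finset ℤ, ∑ l ∈ F, |f n θ l| ≤ K)
    (hlim : ∀ᵐ θ ∂(volume.restrict I), ∀ l, Tendsto (fun n => f n θ l) atTop (𝓝 (f₀ θ l))) :
    Tendsto f atTop (@nhds _ (mixedWeakStar I p) f₀) := by
  have : IsFiniteMeasure (volume.restrict I) := isFiniteMeasure_restrict.2 hI
  have hcoord : ∀ {q : ℝ≥0∞} [Fact (1 ≤ q)] (g : MixedL2 I q) (l : ℤ),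
      AEMeasurable (fun θ => g θ l) (volume.restrict I) := fun {q} _ g l =>
    ((lp.evalCLM ℝ (fun _ : ℤ => ℝ) q l).continuous.comp_aestronglyMeasurable
      (Lp.aestronglyMeasurable g)).aemeasurable
  have hint : ∀ {E : Type} [NormedAddCommGroup E] (g : Lp E 2 (volume.restrict I)),
      Integrable (fun θ => ‖g θ‖) (volume.restrict I) := fun g =>
    ((Lp.memLp g).integrable one_le_two).norm
  by_cases hp1 : p = 1
  · rw [show mixedWeakStar I p = _ from if_pos hp1, nhds_induced, tendsto_comap_iff,
      tendsto_pi_nhds]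
    intro a
    refine tendsto_mixedPairing (fun n l => hcoord (f n) l) (fun l => ?_) hf hlim (hint a)
      (fun θ l => ?_) (fun θ => ?_)
    · have hev : Continuous fun g : SeqC0 => g l :=
        (BoundedContinuousFunction.lipschitz_eval_const (β := ℝ) l).continuous.comp
          ZeroAtInftyContinuousMap.isometry_toBCF.continuous
      exact (hev.comp_aestronglyMeasurable (Lp.aestronglyMeasurable a)).aemeasurable
    · exact ((a θ).toBCF.norm_coe_le_norm l).trans_eq ZeroAtInftyContinuousMap.norm_toBCF_eq_norm
    · rw [← Filter.cocompact_eq_cofinite]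
      exact (a θ).zero_at_infty'
  · rw [show mixedWeakStar I p = _ from if_neg hp1, nhds_induced, tendsto_comap_iff,
      tendsto_pi_nhds]
    intro a
    have hp' : p.conjExponent ≠ ∞ := by
      have h1 : 1 < p := lt_of_le_of_ne Fact.out (Ne.symm hp1)
      simp [ENNReal.conjExponent, h1, tsub_eq_zero_iff_le]
    refine tendsto_mixedPairing (fun n l => hcoord (f n) l) (fun l => hcoord a l) hf hlim (hint a)
      (fun θ l => ?_) (fun θ => lp_tendsto_cofinite_zero hp' (a θ))
    exact lp.norm_apply_le_norm (zero_lt_one.trans_le Fact.out).ne' (a θ) l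

end Pairing

/-! ### The forward operator -/

section ForwardOperator

variable {H : Type*} [NormedAddCommGroup H] [InnerProductSpace ℂ H] [CompleteSpace H]

lemma exists_norm_le_of_bounded_or_unitary {I : Set ℝ} {U : ℝ → H →L[ℂ] H}
    (hU : (∃ C : ℝ, ∀ θ ∈ I, ‖U θ‖ ≤ C) ∨ (∀ θ ∈ I, U θ ∈ unitary (H →L[ℂ] H))) :
    ∃ C : ℝ, ∀ θ ∈ I, ‖U θ‖ ≤ C := by
  rcases hU with h | h
  · exact h
  · refine ⟨1, fun θ hθ => ContinuousLinearMap.opNorm_le_bound _ zero_le_one fun x => ?_⟩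
    rw [one_mul]
    exact (Unitary.norm_map ⟨U θ, h θ hθ⟩ x).le

/-- A uniform bound on the `ℓ¹` norms of the diagonals of `U_θ ρ U_θ*`. -/
lemma sum_abs_re_diagEntry_le {e : ℤ → H} (he : Orthonormal ℂ e) {I : Set ℝ}
    {U : ℝ → H →L[ℂ] H} {C M : ℝ} (hC : ∀ θ ∈ I, ‖U θ‖ ≤ C) {ρ : PosTraceClass H}
    (hM : realTrace (ρ : TraceClass H).1 ≤ M) {θ : ℝ} (hθ : θ ∈ I) (F : Finset ℤ) :
    ∑ l ∈ F, |(diagEntry e U (ρ : TraceClass H).1 θ l).re| ≤ C ^ 2 * M := by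
  simp only [abs_of_nonneg (diagEntry_eq_ofReal_and_nonneg e U ρ θ _).2]
  refine (sum_re_diagEntry_le he U ρ θ F).trans ?_
  have := realTrace_nonneg ρ
  have := hC θ hθ
  gcongr

lemma exists_isForwardOperator {e : ℤ → H} (he : Orthonormal ℂ e) {I : Set ℝ}
    (hI : volume I ≠ ∞) (hI_meas : NullMeasurableSet I volume) {p : ℝ≥0∞} [Fact (1 ≤ p)]
    (hp : p ≠ ∞) {U : ℝ → H →L[ℂ] H}
    (hU_meas : ∀ (ρ : PosTraceClass H) (l : ℤ),
      AEMeasurable (fun θ => diagEntry e U (ρ : TraceClass H) θ l) (volume.restrict I))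
    {C : ℝ} (hC : ∀ θ ∈ I, ‖U θ‖ ≤ C) :
    ∃ T : PosTraceClass H → MixedL2 I p, IsForwardOperator e I U p T := by
  classical
  have : IsFiniteMeasure (volume.restrict I) := isFiniteMeasure_restrict.2 hI
  have key : ∀ ρ : PosTraceClass H, ∃ g : MixedL2 I p, ∀ᵐ θ ∂(volume.restrict I), ∀ l : ℤ,
      ((g θ l : ℝ) : ℂ) = diagEntry e U (ρ : TraceClass H) θ l := by
    intro ρ
    have hsum : ∀ θ ∈ I, ∀ F : Finset ℤ, ∑ l ∈ F, |(diagEntry e U (ρ : TraceClass H).1 θ l).re| ≤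
        C ^ 2 * realTrace (ρ : TraceClass H).1 := fun θ hθ F =>
      sum_abs_re_diagEntry_le he hC le_rfl hθ F
    -- nothing bounds `U θ` for `θ ∉ I`, where the diagonal may fail to lie in `ℓ^p`
    let g : ℝ → SeqLp p := fun θ =>
      if h : Memℓp (fun l : ℤ => (diagEntry e U (ρ : TraceClass H).1 θ l).re) p then ⟨_, h⟩ else 0
    have hg : ∀ θ ∈ I, ∀ l, g θ l = (diagEntry e U (ρ : TraceClass H).1 θ l).re := by
      intro θ hθ l
      have hmem := memℓp_of_sum_abs_le (Fact.out : 1 ≤ p) (hsum θ hθ)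
      simp only [g, dif_pos hmem]
    have hI_ae := ae_restrict_mem₀ hI_meas
    have hgm : AEStronglyMeasurable g (volume.restrict I) := by
      refine aestronglyMeasurable_lp hp fun l => ?_
      refine (Complex.measurable_re.comp_aemeasurable (hU_meas ρ l)).congr ?_
      filter_upwards [hI_ae] with θ hθ
      exact (hg θ hθ l).symm
    have hgL : MemLp g 2 (volume.restrict I) := by
      refine MemLp.of_bound hgm (C ^ 2 * realTrace (ρ : TraceClass H).1) ?_
      filter_upwards [hI_ae] with θ hθ
      refine norm_lp_le_of_sum_abs_le hp fun F => ?_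
      simpa only [hg θ hθ] using hsum θ hθ F
    refine ⟨hgL.toLp g, ?_⟩
    filter_upwards [hgL.coeFn_toLp, hI_ae] with θ h1 h2 l
    rw [h1, hg θ h2, ← (diagEntry_eq_ofReal_and_nonneg e U ρ θ l).1]
  choose T hT using key
  exact ⟨T, hT⟩

end ForwardOperator

theorem lemma2p9 {H : Type*} [NormedAddCommGroup H] [InnerProductSpace ℂ H] [CompleteSpace H]
    [TopologicalSpace.SeparableSpace H]
    (e : ℤ → H) (he : Orthonormal ℂ e)
    (I : Set ℝ) (hI : Bornology.IsBounded I) (hI_meas : NullMeasurableSet I volume)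
    (p : ℝ≥0∞) [Fact (1 ≤ p)] (hp : p ≠ ∞)
    (U : ℝ → H →L[ℂ] H)
    (hU_meas : ∀ (ρ : PosTraceClass H) (l : ℤ),
      AEMeasurable (fun θ => diagEntry e U (ρ : TraceClass H) θ l) (volume.restrict I))
    (hU : (∃ C : ℝ, ∀ θ ∈ I, ‖U θ‖ ≤ C) ∨ (∀ θ ∈ I, U θ ∈ unitary (H →L[ℂ] H))) :
    (∃ T : PosTraceClass H → MixedL2 I p, IsForwardOperator e I U p T) ∧
      ∀ T : PosTraceClass H → MixedL2 I p, IsForwardOperator e I U p T →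
        @SeqContinuous _ _ (posTraceClassWeakStar H) (mixedWeakStar I p) T := by
  obtain ⟨C, hC⟩ := exists_norm_le_of_bounded_or_unitary hU
  have hvol : volume I ≠ ∞ := hI.measure_lt_top.ne
  refine ⟨exists_isForwardOperator he hvol hI_meas hp hU_meas hC, fun T hT ρ ρ₀ hρ => ?_⟩
  obtain ⟨M, hM⟩ := exists_realTrace_le_of_tendsto hρ
  have hval : ∀ ρ : PosTraceClass H, ∀ᵐ θ ∂(volume.restrict I), ∀ l,
      T ρ θ l = (diagEntry e U (ρ : TraceClass H) θ l).re := fun ρ => by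
    filter_upwards [hT ρ] with θ hθ l
    rw [← hθ l, Complex.ofReal_re]
  refine tendsto_mixedWeakStar (K := C ^ 2 * M) hvol (fun n => ?_) ?_
  · filter_upwards [hval (ρ n), ae_restrict_mem₀ hI_meas] with θ h1 h2 F
    simpa only [Function.comp_apply, h1] using sum_abs_re_diagEntry_le he hC (hM n) h2 F
  · filter_upwards [ae_all_iff.2 fun n => hval (ρ n), hval ρ₀] with θ h1 h2 l
    simp only [Function.comp_apply, h1, h2, diagEntry_eq]
    exact (Complex.continuous_re.tendsto _).comp (tendsto_inner_of_tendsto hρ _)
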